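/- Let $H$ be a compact Lie group and $G$ a Lie group (smooth, real, finite-dimensional, Hausdorff; $G$ need not be compact). Let $\mathrm{map}(H,G)$ be the space of continuous group homomorphisms $H\to G$ with the compact-open topology, equipped with the continuous right $G$-action by conjugation, $(\alpha\cdot g)(h)=g^{-1}\alpha(h)g$, and let $\mathrm{Rep}(H,G)=\mathrm{map}(H,G)/G$ be the orbit space with the quotient topology. Then: (i) For each $\alpha\in\mathrm{map}(H,G)$ there is an open neighborhood $V$ of $\alpha$ in $\mathrm{map}(H,G)$ such that each $\beta\in V$ is conjugate to $\alpha$, i.e. $\beta=\alpha\cdot g$ for some $g\in G$. (ii) The quotient topology on $\mathrm{Rep}(H,G)$ is discrete. (iii) All $G$-orbits $\alpha G$ are open in $\mathrm{map}(H,G)$. Moreover, for every choice $\{\alpha_i\}_{i\in I}$ of representatives of the elements of $\mathrm{Rep}(H,G)$ (exactly one for each class), the canonical map $$\coprod_{i\in I}\alpha_i G\longrightarrow \mathrm{map}(H,G),$$ given on each summand by the inclusion of the orbit with its subspace topology, is a $G$-equivariant homeomorphism. -/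

import Mathlib

open scoped Manifold ContDiff

namespace LieHom

variable {H G : Type*} [Group H] [TopologicalSpace H] [Group G] [TopologicalSpace G]
  [IsTopologicalGroup G]

/-- The conjugate `α · g` of a continuous homomorphism `α : H → G` by `g : G`,
that is, the homomorphism `h ↦ g⁻¹ α(h) g`. -/
def conj (α : H →ₜ* G) (g : G) : H →ₜ* G where
  toFun h := g⁻¹ * α h * g
  map_one' := by simp
  map_mul' x y := by simp [mul_assoc]
  continuous_toFun := by fun_prop

/-- The right conjugation action of `G` on the space `H →ₜ* G` of continuous homomorphisms
(a right action of `G` is a left action of `Gᵐᵒᵖ`). -/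
instance conjAction : MulAction Gᵐᵒᵖ (H →ₜ* G) where
  smul g α := conj α g.unop
  one_smul α := by
    apply ContinuousMonoidHom.ext
    intro h
    change (1 : G)⁻¹ * α h * 1 = α h
    simp
  mul_smul a b α := by
    apply ContinuousMonoidHom.ext
    intro h
    change (b.unop * a.unop)⁻¹ * α h * (b.unop * a.unop)
      = a.unop⁻¹ * (b.unop⁻¹ * α h * b.unop) * a.unop
    simp [mul_assoc]

theorem op_smul_apply (g : G) (α : H →ₜ* G) (h : H) :
    (MulOpposite.op g • α) h = g⁻¹ * α h * g := rfl

/-- The conjugation action is continuous for the compact-open topology on `H →ₜ* G`. -/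
instance continuousSMul_conjAction : ContinuousSMul Gᵐᵒᵖ (H →ₜ* G) where
  continuous_smul := by
    refine (ContinuousMonoidHom.isInducing_toContinuousMap H G).continuous_iff.mpr ?_
    have ha : Continuous fun p : Gᵐᵒᵖ × (H →ₜ* G) => p.2.toContinuousMap :=
      (ContinuousMonoidHom.isInducing_toContinuousMap H G).continuous.comp continuous_snd
    let c : C(G × G, G) := ⟨fun q => q.1⁻¹ * q.2 * q.1, by fun_prop⟩
    exact (ContinuousMap.continuous_postcomp c).comp
      (ContinuousMap.continuous_prodMk_const.comp
        ((MulOpposite.continuous_unop.comp continuous_fst).prodMk ha))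

variable (H G) in
/-- `Rep(H, G)`: the quotient of the space of continuous homomorphisms `H → G` by the conjugation
action of `G`. As an abbreviation for a `Quotient`, it carries the quotient topology. -/
abbrev Rep : Type _ := Quotient (MulAction.orbitRel Gᵐᵒᵖ (H →ₜ* G))

end LieHom

namespace LieHom

open Filter Topology MeasureTheory

/-! Near `α`, conjugacy is a Newton iteration driven by the vanishing of the first cohomology of a
compact group. For a trial conjugator `x`, the function `h ↦ x⁻¹ β(h) x α(h)⁻¹` is a crossed
homomorphism; in a chart at `1` it becomes an approximate additive cocycle `u`. Its Haar mean `v`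
makes `u` nearly a coboundary (`exists_mean_value_estimate`), so replacing `x` by `x * φ.symm v`
halves the deviation (`exists_newton_step`). A limit of the iterates has deviation `1` and
conjugates `β` to `α`. Hence orbits are open, and discreteness and the decomposition are formal. -/

theorem _root_.HasStrictFDerivAt.eventually_norm_sub_right_le
    {E F F' : Type*} [NormedAddCommGroup E] [NormedSpace ℝ E] [NormedAddCommGroup F]
    [NormedSpace ℝ F] [NormedAddCommGroup F'] [NormedSpace ℝ F']
    {f : E × F → F'} {f' : E × F →L[ℝ] F'} {x : E} {y : F} (hf : HasStrictFDerivAt f f' (x, y))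
    {ε : ℝ} (hε : 0 < ε) :
    ∀ᶠ p : E × F × F in 𝓝 (x, y, y),
      ‖f (p.1, p.2.1) - f (p.1, p.2.2) - f' (0, p.2.1 - p.2.2)‖ ≤ ε * ‖p.2.1 - p.2.2‖ := by
  have h := hf.isLittleO.def hε
  have ht : Tendsto (fun p : E × F × F => ((p.1, p.2.1), (p.1, p.2.2))) (𝓝 (x, y, y))
      (𝓝 ((x, y), (x, y))) := by
    apply Continuous.tendsto'
    · fun_prop
    · rfl
  filter_upwards [ht.eventually h] with p hp
  simpa [Prod.norm_def] using hp

/-- A chart around the identity of a Lie group, smooth there in both directions, which sends the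
identity to `0`. -/
structure IsCenteredChart {F G : Type*} [NormedAddCommGroup F] [NormedSpace ℝ F]
    [Group G] [TopologicalSpace G] [ChartedSpace F G] (φ : OpenPartialHomeomorph G F) : Prop where
  one_mem : 1 ∈ φ.source
  map_one : φ 1 = 0
  smooth : ContMDiffAt 𝓘(ℝ, F) 𝓘(ℝ, F) ∞ φ 1
  smooth_symm : ContMDiffAt 𝓘(ℝ, F) 𝓘(ℝ, F) ∞ φ.symm 0

/-! ### Chart estimates near the identity. -/

section

variable {F G : Type*} [NormedAddCommGroup F] [NormedSpace ℝ F]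
    [Group G] [TopologicalSpace G] [ChartedSpace F G]

theorem exists_isCenteredChart [LieGroup 𝓘(ℝ, F) ∞ G] :
    ∃ φ : OpenPartialHomeomorph G F, IsCenteredChart φ := by
  have : IsManifold 𝓘(ℝ, F) ∞ G := inferInstance
  have h1 : (1 : G) ∈ (chartAt F (1 : G)).source := mem_chart_source F 1
  refine ⟨(chartAt F (1 : G)).transHomeomorph (Homeomorph.subRight (chartAt F (1 : G) 1)), h1,
    by simp, ?_, ?_⟩
  · have h := (contMDiffOn_chart (I := 𝓘(ℝ, F)) (n := ∞) (x := (1 : G))).contMDiffAt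
      ((chartAt F (1 : G)).open_source.mem_nhds h1)
    have hs : ContMDiff 𝓘(ℝ, F) 𝓘(ℝ, F) ∞ (fun y : F => y - chartAt F (1 : G) 1) :=
      (contDiff_id.sub contDiff_const).contMDiff
    exact hs.contMDiffAt.comp (1 : G) h
  · have h := (contMDiffOn_chart_symm (I := 𝓘(ℝ, F)) (n := ∞) (x := (1 : G))).contMDiffAt
      ((chartAt F (1 : G)).open_target.mem_nhds ((chartAt F (1 : G)).map_source h1))
    have hs : ContMDiff 𝓘(ℝ, F) 𝓘(ℝ, F) ∞ (fun y : F => y + chartAt F (1 : G) 1) :=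
      (contDiff_id.add contDiff_const).contMDiff
    have := ContMDiffAt.comp_of_eq (x := (0 : F)) (g := (chartAt F (1 : G)).symm) h
      hs.contMDiffAt (by simp)
    exact this

namespace IsCenteredChart

variable {φ : OpenPartialHomeomorph G F} (hφ : IsCenteredChart φ)
include hφ

theorem symm_zero : φ.symm 0 = 1 := by
  rw [← hφ.map_one, φ.left_inv hφ.one_mem]

theorem zero_mem : (0 : F) ∈ φ.target := by
  rw [← hφ.map_one]
  exact φ.map_source hφ.one_mem

theorem tendsto_symm : Tendsto φ.symm (𝓝 0) (𝓝 1) := by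
  have := (φ.symm.continuousAt (x := 0) hφ.zero_mem).tendsto
  rwa [hφ.symm_zero] at this

theorem source_mem_nhds : φ.source ∈ 𝓝 (1 : G) := φ.open_source.mem_nhds hφ.one_mem

theorem eventually_right_inv : ∀ᶠ y in 𝓝 (0 : F), φ (φ.symm y) = y :=
  φ.eventually_right_inverse hφ.zero_mem

theorem smooth_symm_fst :
    ContMDiffAt 𝓘(ℝ, F × F) 𝓘(ℝ, F) ∞ (fun p : F × F => φ.symm p.1) (0, 0) :=
  ContMDiffAt.comp (I' := 𝓘(ℝ, F)) (x := ((0, 0) : F × F)) (g := φ.symm) (f := Prod.fst)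
    hφ.smooth_symm contDiff_fst.contMDiff.contMDiffAt

theorem smooth_symm_snd (x : F) :
    ContMDiffAt 𝓘(ℝ, F × F) 𝓘(ℝ, F) ∞ (fun p : F × F => φ.symm p.2) (x, 0) :=
  ContMDiffAt.comp (I' := 𝓘(ℝ, F)) (x := ((x, 0) : F × F)) (g := φ.symm) (f := Prod.snd)
    hφ.smooth_symm contDiff_snd.contMDiff.contMDiffAt

theorem hasStrictFDerivAt {f : F × F → G} {p : F × F}
    (hf : ContMDiffAt 𝓘(ℝ, F × F) 𝓘(ℝ, F) ∞ f p) (h1 : f p = 1) :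
    HasStrictFDerivAt (fun q => φ (f q)) (fderiv ℝ (fun q => φ (f q)) p) p := by
  have h : ContMDiffAt 𝓘(ℝ, F × F) 𝓘(ℝ, F) ∞ (fun q => φ (f q)) p :=
    ContMDiffAt.comp_of_eq (I' := 𝓘(ℝ, F)) (x := p) (g := φ) hφ.smooth hf h1
  exact h.contDiffAt.hasStrictFDerivAt (by simp)

/-- The error involves `‖b‖` alone because the product is compared with its value at `b = 0`, which
is exactly `a`. -/
theorem exists_mul_estimate [LieGroup 𝓘(ℝ, F) ∞ G] [IsTopologicalGroup G] {ε : ℝ} (hε : 0 < ε) :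
    ∃ δ > 0, ∀ a b : F, ‖a‖ ≤ δ → ‖b‖ ≤ δ → φ.symm a * φ.symm b ∈ φ.source ∧
      ‖φ (φ.symm a * φ.symm b) - a - b‖ ≤ ε * ‖b‖ := by
  have : ContMDiffMul 𝓘(ℝ, F) ∞ G := inferInstance
  set f : F × F → F := fun p => φ (φ.symm p.1 * φ.symm p.2) with hf
  have hd := hφ.hasStrictFDerivAt (p := (0, 0))
    (hφ.smooth_symm_fst.mul (hφ.smooth_symm_snd 0)) (by simp [hφ.symm_zero])
  have hfd : ∀ b : F, fderiv ℝ f (0, 0) (0, b) = b := by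
    have h2 : HasFDerivAt (fun y : F => f (0, y))
        ((fderiv ℝ f (0, 0)).comp (ContinuousLinearMap.inr ℝ F F)) 0 :=
      HasFDerivAt.comp (0 : F) (f := fun y : F => ((0 : F), y)) (g := f) hd.hasFDerivAt
        (hasFDerivAt_prodMk_right 0 0)
    have h3 : (fun y : F => f (0, y)) =ᶠ[𝓝 0] _root_.id := by
      filter_upwards [hφ.eventually_right_inv] with y hy
      simp [hf, hφ.symm_zero, hy]
    have h4 := h2.unique ((hasFDerivAt_id (0 : F)).congr_of_eventuallyEq h3)
    intro b
    simpa using congrArg (fun L : F →L[ℝ] F => L b) h4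
  have he := hd.eventually_norm_sub_right_le hε
  have ht : Tendsto (fun p : F × F => (p.1, p.2, (0 : F))) (𝓝 0) (𝓝 (0, 0, 0)) := by
    apply Continuous.tendsto'
    · fun_prop
    · rfl
  have h1 : Tendsto (fun p : F × F => φ.symm p.1 * φ.symm p.2) (𝓝 0) (𝓝 1) := by
    have := (hφ.tendsto_symm.comp (continuous_fst.tendsto' (0 : F × F) 0 rfl)).mul
      (hφ.tendsto_symm.comp (continuous_snd.tendsto' (0 : F × F) 0 rfl))
    simpa using this
  have hev : ∀ᶠ p : F × F in 𝓝 0, φ.symm p.1 * φ.symm p.2 ∈ φ.source ∧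
      ‖φ (φ.symm p.1 * φ.symm p.2) - p.1 - p.2‖ ≤ ε * ‖p.2‖ := by
    filter_upwards [ht.eventually he, h1.eventually hφ.source_mem_nhds,
      (continuous_fst.tendsto' (0 : F × F) 0 rfl).eventually hφ.eventually_right_inv]
      with p hp hs hr
    refine ⟨hs, ?_⟩
    have h5 := hfd p.2
    simp only [hf] at h5
    simpa [hφ.symm_zero, hr, h5] using hp
  obtain ⟨δ, hδ, h⟩ := Metric.nhds_basis_closedBall.eventually_iff.mp hev
  refine ⟨δ, hδ, fun a b ha hb => ?_⟩
  exact h (x := (a, b)) (by simp [Prod.norm_def, ha, hb])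

/-- The map vanishes on the diagonal, so a Lipschitz bound in the second variable, applied between
`(a, b)` and `(a, a)`, suffices. -/
theorem exists_div_estimate [LieGroup 𝓘(ℝ, F) ∞ G] [IsTopologicalGroup G] :
    ∃ C ≥ 1, ∃ δ > 0, ∀ a b : F, ‖a‖ ≤ δ → ‖b‖ ≤ δ → (φ.symm a)⁻¹ * φ.symm b ∈ φ.source ∧
      ‖φ ((φ.symm a)⁻¹ * φ.symm b)‖ ≤ C * ‖b - a‖ := by
  set f : F × F → F := fun p => φ ((φ.symm p.1)⁻¹ * φ.symm p.2) with hf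
  have hd := hφ.hasStrictFDerivAt (p := (0, 0))
    (hφ.smooth_symm_fst.inv.mul (hφ.smooth_symm_snd 0)) (by simp [hφ.symm_zero])
  have he := hd.eventually_norm_sub_right_le one_pos
  have ht : Tendsto (fun p : F × F => (p.1, p.2, p.1)) (𝓝 0) (𝓝 (0, 0, 0)) := by
    apply Continuous.tendsto'
    · fun_prop
    · rfl
  have h1 : Tendsto (fun p : F × F => (φ.symm p.1)⁻¹ * φ.symm p.2) (𝓝 0) (𝓝 1) := by
    have := (hφ.tendsto_symm.comp (continuous_fst.tendsto' (0 : F × F) 0 rfl)).inv.mul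
      (hφ.tendsto_symm.comp (continuous_snd.tendsto' (0 : F × F) 0 rfl))
    simpa using this
  have hev : ∀ᶠ p : F × F in 𝓝 0, (φ.symm p.1)⁻¹ * φ.symm p.2 ∈ φ.source ∧
      ‖φ ((φ.symm p.1)⁻¹ * φ.symm p.2)‖ ≤ (1 + ‖fderiv ℝ f (0, 0)‖) * ‖p.2 - p.1‖ := by
    filter_upwards [ht.eventually he, h1.eventually hφ.source_mem_nhds] with p hp hs
    refine ⟨hs, ?_⟩
    have h0 : f (p.1, p.1) = 0 := by simp [hf, hφ.map_one]
    change ‖f (p.1, p.2) - f (p.1, p.1) - fderiv ℝ f (0, 0) (0, p.2 - p.1)‖ ≤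
      1 * ‖p.2 - p.1‖ at hp
    have h6 := (fderiv ℝ f (0, 0)).le_opNorm (0, p.2 - p.1)
    have h7 : ‖((0 : F), p.2 - p.1)‖ = ‖p.2 - p.1‖ := by simp [Prod.norm_def]
    rw [h7] at h6
    rw [h0, sub_zero] at hp
    have h8 := norm_le_norm_sub_add (f (p.1, p.2)) (fderiv ℝ f (0, 0) (0, p.2 - p.1))
    change ‖f (p.1, p.2)‖ ≤ _
    linarith
  obtain ⟨δ, hδ, h⟩ := Metric.nhds_basis_closedBall.eventually_iff.mp hev
  refine ⟨1 + ‖fderiv ℝ f (0, 0)‖, by simp, δ, hδ, fun a b ha hb => ?_⟩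
  exact h (x := (a, b)) (by simp [Prod.norm_def, ha, hb])

theorem exists_eventually_conj_estimate [LieGroup 𝓘(ℝ, F) ∞ G] [IsTopologicalGroup G] (g₀ : G)
    {ε : ℝ} (hε : 0 < ε) :
    ∃ D : F →L[ℝ] F, ∀ᶠ p : G × F in 𝓝 (g₀, 0), p.1 * φ.symm p.2 * p.1⁻¹ ∈ φ.source ∧
      ‖φ (p.1 * φ.symm p.2 * p.1⁻¹) - D p.2‖ ≤ ε * ‖p.2‖ := by
  have : IsManifold 𝓘(ℝ, F) ∞ G := inferInstance
  set χ := chartAt F g₀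
  have hg : g₀ ∈ χ.source := mem_chart_source F g₀
  have hχ : ContMDiffAt 𝓘(ℝ, F × F) 𝓘(ℝ, F) ∞ (fun p : F × F => χ.symm p.1) (χ g₀, 0) :=
    ContMDiffAt.comp (I' := 𝓘(ℝ, F)) (x := ((χ g₀, 0) : F × F)) (g := χ.symm) (f := Prod.fst)
      ((contMDiffOn_chart_symm (I := 𝓘(ℝ, F)) (n := ∞) (x := g₀)).contMDiffAt
        (χ.open_target.mem_nhds (χ.map_source hg))) contDiff_fst.contMDiff.contMDiffAt
  set f : F × F → F := fun p => φ (χ.symm p.1 * φ.symm p.2 * (χ.symm p.1)⁻¹) with hf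
  have hd := hφ.hasStrictFDerivAt (p := (χ g₀, 0))
    ((hχ.mul (hφ.smooth_symm_snd _)).mul hχ.inv) (by simp [hφ.symm_zero])
  have he := hd.eventually_norm_sub_right_le hε
  have ht : Tendsto (fun p : G × F => (χ p.1, p.2, (0 : F))) (𝓝 (g₀, 0)) (𝓝 (χ g₀, 0, 0)) := by
    refine Tendsto.prodMk_nhds ?_ (Tendsto.prodMk_nhds ?_ tendsto_const_nhds)
    · exact (χ.continuousAt hg).tendsto.comp (continuous_fst.tendsto' (g₀, (0 : F)) _ rfl)
    · exact continuous_snd.tendsto' (g₀, (0 : F)) _ rfl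
  have hfst : Tendsto (fun p : G × F => p.1) (𝓝 (g₀, 0)) (𝓝 g₀) :=
    continuous_fst.tendsto' (g₀, (0 : F)) _ rfl
  have h1 : Tendsto (fun p : G × F => p.1 * φ.symm p.2 * p.1⁻¹) (𝓝 (g₀, 0)) (𝓝 1) := by
    have := (hfst.mul (hφ.tendsto_symm.comp (continuous_snd.tendsto' (g₀, (0 : F)) 0 rfl))).mul
      hfst.inv
    simpa using this
  refine ⟨(fderiv ℝ f (χ g₀, 0)).comp (ContinuousLinearMap.inr ℝ F F), ?_⟩
  filter_upwards [ht.eventually he, h1.eventually hφ.source_mem_nhds,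
    hfst.eventually (χ.eventually_left_inverse hg)] with p hp hs hl
  refine ⟨hs, ?_⟩
  simpa [hφ.symm_zero, hφ.map_one, hl, hf] using hp

/-- `D` stands in for `Ad (α h)`. Finitely many derivatives serve all `h` up to `ε`, by compactness,
so `D` need not be continuous in `h`. -/
theorem exists_conj_estimate [LieGroup 𝓘(ℝ, F) ∞ G] [IsTopologicalGroup G]
    {H : Type*} [TopologicalSpace H] [CompactSpace H] {α : H → G} (hα : Continuous α)
    {ε : ℝ} (hε : 0 < ε) :
    ∃ C : ℝ, ∃ δ > 0, ∀ h, ∃ D : F →L[ℝ] F, ‖D‖ ≤ C ∧ ∀ y : F, ‖y‖ ≤ δ →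
      α h * φ.symm y * (α h)⁻¹ ∈ φ.source ∧
      ‖φ (α h * φ.symm y * (α h)⁻¹) - D y‖ ≤ ε * ‖y‖ := by
  have := isCompact_univ.induction_on (X := H)
    (p := fun s => ∃ C : ℝ, ∃ δ > 0, ∀ h ∈ s, ∃ D : F →L[ℝ] F, ‖D‖ ≤ C ∧ ∀ y : F, ‖y‖ ≤ δ →
      α h * φ.symm y * (α h)⁻¹ ∈ φ.source ∧
      ‖φ (α h * φ.symm y * (α h)⁻¹) - D y‖ ≤ ε * ‖y‖) ⟨0, 1, one_pos, by simp⟩ ?_ ?_ ?_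
  · obtain ⟨C, δ, hδ, h⟩ := this
    exact ⟨C, δ, hδ, fun x => h x (Set.mem_univ x)⟩
  · rintro s t hst ⟨C, δ, hδ, h⟩
    exact ⟨C, δ, hδ, fun x hx => h x (hst hx)⟩
  · rintro s t ⟨C, δ, hδ, h⟩ ⟨C', δ', hδ', h'⟩
    refine ⟨max C C', min δ δ', lt_min hδ hδ', ?_⟩
    rintro x (hx | hx)
    · obtain ⟨D, hD, hy⟩ := h x hx
      exact ⟨D, hD.trans (le_max_left _ _), fun y hyy => hy y (hyy.trans (min_le_left _ _))⟩
    · obtain ⟨D, hD, hy⟩ := h' x hx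
      exact ⟨D, hD.trans (le_max_right _ _), fun y hyy => hy y (hyy.trans (min_le_right _ _))⟩
  · intro h₀ _
    obtain ⟨D, hD⟩ := hφ.exists_eventually_conj_estimate (α h₀) hε
    rw [nhds_prod_eq] at hD
    obtain ⟨U, hU, V, hV, hUV⟩ := eventually_prod_iff.mp hD
    obtain ⟨δ, hδ, hb⟩ := Metric.nhds_basis_closedBall.eventually_iff.mp hV
    refine ⟨α ⁻¹' {g | U g}, mem_nhdsWithin_of_mem_nhds (hα.continuousAt.tendsto.eventually hU),
      ‖D‖, δ, hδ, fun h hh => ⟨D, le_rfl, fun y hy => ?_⟩⟩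
    exact hUV hh (hb (by simpa using hy))

end IsCenteredChart

end

/-! ### The deviation as a crossed homomorphism. -/

section

variable {H G : Type*} [Group H] [TopologicalSpace H] [Group G] [TopologicalSpace G]

/-- The deviation of `g⁻¹ β g` from `α`, as a function `H → G`. -/
def deviation (α β : H →ₜ* G) (g : G) (h : H) : G := g⁻¹ * β h * g * (α h)⁻¹

theorem continuous_deviation [IsTopologicalGroup G] (α β : H →ₜ* G) (g : G) :
    Continuous (deviation α β g) := by
  unfold deviation
  fun_prop

theorem deviation_mul (α β : H →ₜ* G) (g : G) (h k : H) :
    deviation α β g (h * k) = deviation α β g h * (α h * deviation α β g k * (α h)⁻¹) := by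
  simp only [deviation, map_mul]
  group

/-- Changing the conjugator changes the deviation by a twisted coboundary, which the averaging step
uses to cancel it. -/
theorem deviation_mul_right (α β : H →ₜ* G) (g x : G) (h : H) :
    deviation α β (g * x) h = x⁻¹ * (deviation α β g h * (α h * x * (α h)⁻¹)) := by
  simp only [deviation]
  group

end

/-! ### Averaging and Newton iteration. -/

section

variable {F G : Type*} [NormedAddCommGroup F] [NormedSpace ℝ F] [FiniteDimensional ℝ F]
    [Group G] [TopologicalSpace G] [IsTopologicalGroup G]
    [ChartedSpace F G] [LieGroup 𝓘(ℝ, F) ∞ G]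
    {H : Type*} [Group H] [TopologicalSpace H] [IsTopologicalGroup H] [CompactSpace H]

/-- An averaging step over a compact group: an approximate crossed homomorphism `u : H → F` is
close to the coboundary of its mean value. -/
theorem exists_mean_value_estimate {u : H → F} (hu : Continuous u) {D : H → F →L[ℝ] F} {N η : ℝ}
    (hN : ∀ h, ‖u h‖ ≤ N) (hη : ∀ h k, ‖u (h * k) - u h - D h (u k)‖ ≤ η) :
    ∃ v : F, ‖v‖ ≤ N ∧ ∀ h, ‖v - u h - D h v‖ ≤ η := by
  let _ : MeasurableSpace H := borel H
  have : BorelSpace H := ⟨rfl⟩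
  let μ : Measure H := Measure.haarMeasure ⊤
  have : IsProbabilityMeasure μ := ⟨by
    have := Measure.haarMeasure_self (K₀ := (⊤ : TopologicalSpace.PositiveCompacts H))
    simpa using this⟩
  have hint : ∀ {w : H → F}, Continuous w → Integrable w μ := fun hw =>
    hw.integrable_of_hasCompactSupport (HasCompactSupport.of_compactSpace _)
  refine ⟨∫ k, u k ∂μ, ?_, fun h => ?_⟩
  · simpa using norm_integral_le_of_norm_le_const (μ := μ) (Eventually.of_forall hN)
  -- Integrate the cocycle inequality over `k` with `h` fixed: left invariance turns the first term
  -- into the mean, and no regularity of `D` in `h` is needed.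
  · have h1 : ∫ k, u (h * k) ∂μ = ∫ k, u k ∂μ := integral_mul_left_eq_self u h
    have h2 : ∫ k, (u (h * k) - u h - D h (u k)) ∂μ
        = ∫ k, u k ∂μ - u h - D h (∫ k, u k ∂μ) := by
      have i1 : Integrable (fun k => u (h * k)) μ := hint (by fun_prop)
      have i2 : Integrable (fun k => D h (u k)) μ := hint (by fun_prop)
      have i3 : Integrable (fun k => u (h * k) - u h) μ := hint (by fun_prop)
      rw [integral_sub i3 i2, integral_sub i1 (integrable_const _), h1,
        ContinuousLinearMap.integral_comp_comm _ (hint hu)]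
      simp
    rw [← h2]
    simpa using norm_integral_le_of_norm_le_const (μ := μ) (Eventually.of_forall (hη h))

/-- The bound `4 * (N₀ - N)` is a travel budget: a step moves `φ x` by at most `2 * N`, exactly what
halving `N` releases. -/
theorem IsCenteredChart.exists_newton_step {φ : OpenPartialHomeomorph G F} (hφ : IsCenteredChart φ)
    (α : H →ₜ* G) :
    ∃ N₀ > 0, Metric.closedBall 0 (4 * N₀) ⊆ φ.target ∧ ∀ (β : H →ₜ* G) (x : G) (N : ℝ), N ≤ N₀ →
      x ∈ φ.source → ‖φ x‖ ≤ 4 * (N₀ - N) →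
      (∀ h, deviation α β x h ∈ φ.source ∧ ‖φ (deviation α β x h)‖ ≤ N) →
      ∃ y ∈ φ.source, ‖φ y‖ ≤ 4 * (N₀ - N / 2) ∧
        ∀ h, deviation α β y h ∈ φ.source ∧ ‖φ (deviation α β y h)‖ ≤ N / 2 := by
  obtain ⟨B, hB1, δ₁, hδ₁, hdiv⟩ := hφ.exists_div_estimate
  -- A crude estimate with error `1` fixes `C` first, since `ε` must be chosen in terms of `C`.
  obtain ⟨C', δ₂, hδ₂, hconj₁⟩ := hφ.exists_conj_estimate α.continuous_toFun one_pos
  obtain ⟨C, hC1, hCC⟩ : ∃ C : ℝ, 1 ≤ C ∧ C' + 1 ≤ C := ⟨max 1 (C' + 1), by simp, by simp⟩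
  have hconjC : ∀ h, ∀ y : F, ‖y‖ ≤ δ₂ → ‖φ (α h * φ.symm y * (α h)⁻¹)‖ ≤ C * ‖y‖ := by
    intro h y hy
    obtain ⟨D, hD, hD'⟩ := hconj₁ h
    have h1 := (hD' y hy).2
    have h2 := D.le_opNorm y
    have h3 := norm_le_norm_sub_add (φ (α h * φ.symm y * (α h)⁻¹)) (D y)
    have h4 : ‖D‖ * ‖y‖ ≤ C' * ‖y‖ := by gcongr
    have h5 : (C' + 1) * ‖y‖ ≤ C * ‖y‖ := by gcongr
    change ‖φ (α h * φ.symm y * (α h)⁻¹) - D y‖ ≤ 1 * ‖y‖ at h1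
    linarith
  obtain ⟨ε, hε, hε1, hεB⟩ : ∃ ε : ℝ, 0 < ε ∧ ε ≤ 1 ∧ B * (2 * (ε * (C + 1))) ≤ 1 / 2 := by
    have hp : 0 < B * (C + 1) := by positivity
    refine ⟨1 / (4 * (B * (C + 1))), by positivity, ?_, le_of_eq ?_⟩
    · rw [div_le_one (by positivity)]
      nlinarith
    · have : B ≠ 0 := by positivity
      have : C + 1 ≠ 0 := by positivity
      field_simp
      norm_num
  obtain ⟨δ₃, hδ₃, hmul⟩ := hφ.exists_mul_estimate hε
  obtain ⟨C₄, δ₄, hδ₄, hconj⟩ := hφ.exists_conj_estimate α.continuous_toFun hε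
  choose D _ hD using hconj
  obtain ⟨δ₅, hδ₅, htar⟩ :=
    Metric.nhds_basis_closedBall.mem_iff.mp (φ.open_target.mem_nhds hφ.zero_mem)
  obtain ⟨δ, hδ, hδ'⟩ : ∃ δ > 0, δ ≤ δ₁ ∧ δ ≤ δ₂ ∧ δ ≤ δ₃ ∧ δ ≤ δ₄ ∧ δ ≤ δ₅ :=
    ⟨min δ₁ (min δ₂ (min δ₃ (min δ₄ δ₅))), by positivity, by simp⟩
  -- `4 * N₀` bounds the iterates in the chart; `(1 + 2 * C) * N₀` bounds the product `deviation *
  -- conjugate` in `key`.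
  obtain ⟨N₀, hN₀, h4N, hCN⟩ : ∃ N₀ : ℝ, 0 < N₀ ∧ 4 * N₀ ≤ δ ∧ (1 + 2 * C) * N₀ ≤ δ := by
    refine ⟨min (δ / 4) (δ / (1 + 2 * C)), by positivity, ?_, ?_⟩
    · linarith [min_le_left (δ / 4) (δ / (1 + 2 * C))]
    · have := min_le_right (δ / 4) (δ / (1 + 2 * C))
      rwa [le_div_iff₀' (by positivity)] at this
  refine ⟨N₀, hN₀, (Metric.closedBall_subset_closedBall (by linarith)).trans htar, ?_⟩
  intro β x N hN hx hxN hdev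
  set u : H → F := fun h => φ (deviation α β x h) with hu
  have hinv : ∀ h, φ.symm (u h) = deviation α β x h := fun h => φ.left_inv (hdev h).1
  have huN : ∀ h, ‖u h‖ ≤ N := fun h => (hdev h).2
  have hN0 : 0 ≤ N := (norm_nonneg _).trans (huN 1)
  have hCN' : (1 + 2 * C) * N ≤ δ := le_trans (by gcongr) hCN
  have hCN0 : 0 ≤ C * N := by positivity
  have hucont : Continuous u :=
    φ.continuousOn.comp_continuous (continuous_deviation α β x) fun h => (hdev h).1
  have key : ∀ h, ∀ y : F, ‖y‖ ≤ N →
      deviation α β x h * (α h * φ.symm y * (α h)⁻¹) ∈ φ.source ∧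
      ‖φ (deviation α β x h * (α h * φ.symm y * (α h)⁻¹)) - u h - D h y‖ ≤ ε * (C + 1) * N ∧
      ‖φ (deviation α β x h * (α h * φ.symm y * (α h)⁻¹))‖ ≤ δ := by
    intro h y hy
    obtain ⟨hs, hDy⟩ := hD h y (by linarith)
    have ha := hconjC h y (by linarith)
    change α h * φ.symm y * (α h)⁻¹ ∈ φ.source at hs
    change ‖φ (α h * φ.symm y * (α h)⁻¹) - D h y‖ ≤ _ at hDy
    set a := φ (α h * φ.symm y * (α h)⁻¹) with ha_def
    have hCy : C * ‖y‖ ≤ C * N := by gcongr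
    have hεy : ε * ‖y‖ ≤ ε * N := by gcongr
    have hm := hmul (u h) a (by linarith [huN h]) (by linarith)
    rw [hinv h, ha_def, φ.left_inv hs, ← ha_def] at hm
    refine ⟨hm.1, ?_, ?_⟩
    · have h1 := norm_sub_le_norm_sub_add_norm_sub
        (φ (deviation α β x h * (α h * φ.symm y * (α h)⁻¹)) - u h) a (D h y)
      have h2 : ε * ‖a‖ ≤ ε * (C * N) := by gcongr; linarith
      linarith [hm.2]
    · have h1 := norm_le_norm_sub_add
        (φ (deviation α β x h * (α h * φ.symm y * (α h)⁻¹)) - u h) a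
      have h2 := norm_le_norm_sub_add
        (φ (deviation α β x h * (α h * φ.symm y * (α h)⁻¹))) (u h)
      have h3 : ε * ‖a‖ ≤ 1 * ‖a‖ := by gcongr
      linarith [hm.2, huN h]
  obtain ⟨v, hvN, hv⟩ := exists_mean_value_estimate hucont huN (D := D) (η := ε * (C + 1) * N) <| by
    intro h k
    have := (key h (u k) (huN k)).2.1
    rwa [hinv k, ← deviation_mul] at this
  have hx4 : ‖φ x‖ ≤ δ := by linarith
  obtain ⟨hxv, hxv'⟩ := hmul (φ x) v (by linarith) (by linarith)
  rw [φ.left_inv hx] at hxv hxv'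
  refine ⟨x * φ.symm v, hxv, ?_, fun h => ?_⟩
  · have h1 := norm_le_norm_sub_add (φ (x * φ.symm v) - φ x) v
    have h2 := norm_le_norm_sub_add (φ (x * φ.symm v)) (φ x)
    have h3 : ε * ‖v‖ ≤ 1 * ‖v‖ := by gcongr
    linarith
  · obtain ⟨hs, hw, hwδ⟩ := key h v hvN
    have hd := hdiv v (φ (deviation α β x h * (α h * φ.symm v * (α h)⁻¹))) (by linarith)
      (by linarith)
    rw [φ.left_inv hs, ← deviation_mul_right] at hd
    refine ⟨hd.1, hd.2.trans ?_⟩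
    set w := φ (deviation α β x h * (α h * φ.symm v * (α h)⁻¹))
    -- Both `w` and `v` are within `ε * (C + 1) * N` of `u h + D h v`.
    have h1 : ‖w - v‖ ≤ 2 * (ε * (C + 1) * N) := by
      have h2 : w - v = (w - u h - D h v) - (v - u h - D h v) := by abel
      rw [h2]
      linarith [norm_sub_le (w - u h - D h v) (v - u h - D h v), hv h]
    calc B * ‖w - v‖ ≤ B * (2 * (ε * (C + 1) * N)) := by gcongr
      _ = B * (2 * (ε * (C + 1))) * N := by ring
      _ ≤ 1 / 2 * N := by gcongr
      _ = N / 2 := by ring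

/-- Homomorphisms close to a given homomorphism from a compact group to a Lie group are conjugate
to it. -/
theorem IsCenteredChart.exists_nhds_forall_conj [T2Space G] {φ : OpenPartialHomeomorph G F}
    (hφ : IsCenteredChart φ) (α : H →ₜ* G) :
    ∃ W : Set G, IsOpen W ∧ 1 ∈ W ∧ ∀ β : H →ₜ* G, (∀ h, β h * (α h)⁻¹ ∈ W) →
      ∃ g : G, ∀ h, β h = g⁻¹ * α h * g := by
  obtain ⟨N₀, hN₀, hball, hstep⟩ := hφ.exists_newton_step α
  refine ⟨φ.source ∩ φ ⁻¹' Metric.ball 0 N₀, φ.isOpen_inter_preimage Metric.isOpen_ball,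
    ⟨hφ.one_mem, by simp [hφ.map_one, hN₀]⟩, fun β hβ => ?_⟩
  have hseq : ∀ n : ℕ, ∃ x ∈ φ.source, ‖φ x‖ ≤ 4 * (N₀ - N₀ / 2 ^ n) ∧
      ∀ h, deviation α β x h ∈ φ.source ∧ ‖φ (deviation α β x h)‖ ≤ N₀ / 2 ^ n := by
    intro n
    induction n with
    | zero =>
      refine ⟨1, hφ.one_mem, by simp [hφ.map_one], fun h => ?_⟩
      have h1 : deviation α β 1 h = β h * (α h)⁻¹ := by simp [deviation]
      rw [h1]
      refine ⟨(hβ h).1, ?_⟩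
      have := (hβ h).2
      simp only [Set.mem_preimage, mem_ball_zero_iff] at this
      simpa using this.le
    | succ n ih =>
      obtain ⟨x, hx, hxn, hdev⟩ := ih
      obtain ⟨y, hy⟩ := hstep β x (N₀ / 2 ^ n) (div_le_self hN₀.le (one_le_pow₀ one_le_two))
        hx hxn hdev
      exact ⟨y, by simpa only [pow_succ, div_div] using hy⟩
  choose x hx hxn hdev using hseq
  have hmem : ∀ n, φ (x n) ∈ Metric.closedBall (0 : F) (4 * N₀) := by
    intro n
    have : 0 < N₀ / 2 ^ n := by positivity
    rw [mem_closedBall_zero_iff]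
    linarith [hxn n]
  -- A convergent subsequence is enough, since the deviations tend to `1` along any subsequence.
  obtain ⟨a, ha, s, hs, hlim⟩ := (isCompact_closedBall (0 : F) (4 * N₀)).tendsto_subseq hmem
  have hxlim : Tendsto (fun n => x (s n)) atTop (𝓝 (φ.symm a)) := by
    have := (φ.symm.continuousAt (x := a) (hball ha)).tendsto.comp hlim
    refine this.congr fun n => ?_
    simp [φ.left_inv (hx (s n))]
  have hdev1 : ∀ h, deviation α β (φ.symm a) h = 1 := by
    intro h
    have h1 : Tendsto (fun n => deviation α β (x (s n)) h) atTop
        (𝓝 (deviation α β (φ.symm a) h)) :=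
      ((hxlim.inv.mul tendsto_const_nhds).mul hxlim).mul tendsto_const_nhds
    refine tendsto_nhds_unique h1 ?_
    have h2 : Tendsto (fun n => N₀ / 2 ^ n) atTop (𝓝 (0 : ℝ)) :=
      tendsto_const_nhds.div_atTop (tendsto_pow_atTop_atTop_of_one_lt one_lt_two)
    have h3 : Tendsto (fun n => φ (deviation α β (x (s n)) h)) atTop (𝓝 0) :=
      squeeze_zero_norm (fun n => (hdev (s n) h).2) (h2.comp hs.tendsto_atTop)
    refine (hφ.tendsto_symm.comp h3).congr fun n => ?_
    simp [φ.left_inv (hdev (s n) h).1]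
  refine ⟨(φ.symm a)⁻¹, fun h => ?_⟩
  have h1 := mul_inv_eq_one.mp (hdev1 h)
  rw [← h1]
  group

end

/-! ### Open orbits and their topological consequences. -/

section

variable {H G : Type*} [Group H] [TopologicalSpace H] [Group G] [TopologicalSpace G]
  [IsTopologicalGroup G]

/-- Since `H` is compact, sending all of `H` into `W` is an open condition in the compact-open
topology. -/
theorem isOpen_setOf_forall_mul_inv_mem [IsTopologicalGroup H] [CompactSpace H] (α : H →ₜ* G)
    {W : Set G} (hW : IsOpen W) : IsOpen {β : H →ₜ* G | ∀ h, β h * (α h)⁻¹ ∈ W} := by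
  have hc : Continuous fun β : H →ₜ* G => β.toContinuousMap * ⟨fun h => (α h)⁻¹, by fun_prop⟩ :=
    (ContinuousMonoidHom.isInducing_toContinuousMap H G).continuous.mul continuous_const
  convert (ContinuousMap.isOpen_setOfPred_mapsTo isCompact_univ hW).preimage hc using 1
  ext β
  exact ⟨fun hβ h _ => hβ h, fun hβ h => hβ (Set.mem_univ h)⟩

end

section

variable {Γ X : Type*} [Group Γ] [TopologicalSpace X] [MulAction Γ X]

theorem discreteTopology_quotient_of_isOpen_orbit
    (h : ∀ x : X, IsOpen (MulAction.orbit Γ x)) :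
    DiscreteTopology (Quotient (MulAction.orbitRel Γ X)) := by
  refine discreteTopology_iff_isOpen_singleton.mpr fun q => ?_
  induction q using Quotient.inductionOn with | h x =>
  rw [← isQuotientMap_quotient_mk'.isOpen_preimage]
  convert h x using 1
  ext y
  exact Quotient.eq''

theorem exists_homeomorph_sigma_orbit (h : ∀ x : X, IsOpen (MulAction.orbit Γ x))
    {ι : Type*} {x : ι → X}
    (hx : Function.Bijective fun i => (Quotient.mk (MulAction.orbitRel Γ X) (x i))) :
    ∃ Φ : (Σ i, MulAction.orbit Γ (x i)) ≃ₜ X,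
      (∀ (i : ι) (y : MulAction.orbit Γ (x i)), Φ ⟨i, y⟩ = y) ∧
      ∀ (g : Γ) (y : Σ i, MulAction.orbit Γ (x i)), Φ (g • y) = g • Φ y := by
  let f : (Σ i, MulAction.orbit Γ (x i)) → X := fun y => y.2
  have hmk : ∀ i (y : MulAction.orbit Γ (x i)),
      Quotient.mk (MulAction.orbitRel Γ X) (y : X) = Quotient.mk _ (x i) :=
    fun i y => Quotient.sound y.2
  have hf : Function.Bijective f := by
    constructor
    · rintro ⟨i, y⟩ ⟨j, z⟩ (hyz : (y : X) = z)
      obtain rfl : i = j := hx.1 ((hmk i y).symm.trans ((congrArg _ hyz).trans (hmk j z)))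
      rw [Subtype.ext hyz]
    · intro y
      obtain ⟨i, hi⟩ := hx.2 (Quotient.mk _ y)
      exact ⟨⟨i, y, Quotient.exact hi.symm⟩, rfl⟩
  have hcont : Continuous f := continuous_sigma fun i => continuous_subtype_val
  have hopen : IsOpenMap f := isOpenMap_sigma.mpr fun i => (h (x i)).isOpenMap_subtype_val
  exact ⟨(Equiv.ofBijective f hf).toHomeomorphOfContinuousOpen hcont hopen,
    fun _ _ => rfl, fun _ _ => rfl⟩

end

end LieHom

theorem proposition2p4
    {E F H G : Type*}
    [NormedAddCommGroup E] [NormedSpace ℝ E] [FiniteDimensional ℝ E]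
    [NormedAddCommGroup F] [NormedSpace ℝ F] [FiniteDimensional ℝ F]
    -- `H` is a compact Lie group
    [Group H] [TopologicalSpace H] [T2Space H] [ChartedSpace E H] [LieGroup 𝓘(ℝ, E) ∞ H]
    [CompactSpace H]
    -- `G` is a Lie group (in particular a topological group)
    [Group G] [TopologicalSpace G] [T2Space G] [ChartedSpace F G] [LieGroup 𝓘(ℝ, F) ∞ G]
    [IsTopologicalGroup G] :
    (∀ α : H →ₜ* G, ∃ V : Set (H →ₜ* G), IsOpen V ∧ α ∈ V ∧
      ∀ β ∈ V, ∃ g : G, ∀ h : H, β h = g⁻¹ * α h * g) ∧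
    DiscreteTopology (LieHom.Rep H G) ∧
    (∀ α : H →ₜ* G, IsOpen (MulAction.orbit Gᵐᵒᵖ α)) ∧
    -- for every choice of representatives `α i` of the classes in `Rep(H, G)`, the canonical map
    -- from the topological disjoint union of their orbits is an equivariant homeomorphism
    (∀ (ι : Type*) (α : ι → (H →ₜ* G)),
      Function.Bijective (fun i => (Quotient.mk _ (α i) : LieHom.Rep H G)) →
      ∃ Φ : (Σ i, MulAction.orbit Gᵐᵒᵖ (α i)) ≃ₜ (H →ₜ* G),
        (∀ (i : ι) (x : MulAction.orbit Gᵐᵒᵖ (α i)), Φ ⟨i, x⟩ = x) ∧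
        ∀ (g : Gᵐᵒᵖ) (x : Σ i, MulAction.orbit Gᵐᵒᵖ (α i)), Φ (g • x) = g • Φ x) := by
  have : IsTopologicalGroup H := topologicalGroup_of_lieGroup 𝓘(ℝ, E) ∞
  have hconj : ∀ α : H →ₜ* G, ∃ V : Set (H →ₜ* G), IsOpen V ∧ α ∈ V ∧
      ∀ β ∈ V, ∃ g : G, ∀ h : H, β h = g⁻¹ * α h * g := by
    intro α
    obtain ⟨φ, hφ⟩ := LieHom.exists_isCenteredChart (F := F) (G := G)
    obtain ⟨W, hW, h1, hβ⟩ := hφ.exists_nhds_forall_conj α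
    exact ⟨_, LieHom.isOpen_setOf_forall_mul_inv_mem α hW, fun h => by simpa using h1, hβ⟩
  have hopen : ∀ α : H →ₜ* G, IsOpen (MulAction.orbit Gᵐᵒᵖ α) := by
    refine fun α => isOpen_iff_mem_nhds.mpr fun β hβ => ?_
    obtain ⟨V, hV, hβV, h⟩ := hconj β
    refine Filter.mem_of_superset (hV.mem_nhds hβV) fun γ hγ => ?_
    obtain ⟨g, hg⟩ := h γ hγ
    -- The neighborhood was taken around `β`, so the orbit is re-based there.
    rw [← MulAction.orbit_eq_iff.mpr hβ]
    exact ⟨MulOpposite.op g, ContinuousMonoidHom.ext fun h => (hg h).symm⟩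
  exact ⟨hconj, LieHom.discreteTopology_quotient_of_isOpen_orbit hopen, hopen,
    fun ι α hα => LieHom.exists_homeomorph_sigma_orbit hopen hα⟩
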